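/- Let $d,k,m\in\mathbb{N}$, $T>0$, $\Omega=(-1,1)^d$ and $\mathcal{B}=\Omega\times(0,T)$. For $n,e\in\mathbb{N}$ put $A_{n,e}=\{\alpha\in\mathbb{N}^e:\|\alpha\|_\infty\le n\}$. *Grid and weights.* Let $p_0<\dots<p_n$ be the $n+1$ roots of the Legendre polynomial of degree $n+1$. For $\alpha\in A_{n,d+1}$ let $(x_\alpha,t_\alpha)=\big((p_{\alpha_1},\dots,p_{\alpha_d}),\tfrac T2(p_{\alpha_{d+1}}+1)\big)\in\mathcal{B}$ be the points of the Legendre grid of degree $n$ rescaled to $\mathcal{B}$, let $L_\alpha$ be the associated tensor-product Lagrange basis polynomials, and let $\omega_\alpha=\|L_\alpha\|_{L^2(\mathcal{B})}^2$ be the Gauss–Legendre weights. *Surrogate.* Let $T_\alpha(x,t)=\prod_{i=1}^d T_{\alpha_i}(x_i)\cdot T_{\alpha_{d+1}}(2t/T-1)$, $\alpha\in A_{k,d+1}$, be the tensor-product Chebyshev polynomials on $\mathcal{B}$. For parameters $\theta\in\mathbb{R}^{A_{k,d+1}}$, $\beta\in\mathbb{R}$, $C\in\mathbb{R}^{A_{m,d}}$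 let $Q_\theta=\sum_{\alpha\in A_{k,d+1}}\theta_\alpha T_\alpha$, let $\tilde s(x)=\sum_{\alpha\in A_{m,d}}C_\alpha x^\alpha$ be the approximate shock, let $U_-=\{(x,t):t\le\tilde s(x)\}$ and $U_+=\{(x,t):t>\tilde s(x)\}$, and let $H_{\tilde s}$ be the indicator function of $U_-$. For a function $g:\mathcal{B}\to\mathbb{R}$ the continuous reconstruction loss is $$\mathcal{L}[\theta,\beta,C]=\int_\Omega\int_0^T\big(Q_\theta(x,t)+\beta H_{\tilde s}(x,t)-g(x,t)\big)^2\,dt\,dx .$$ *Discrete loss.* Let $A^\pm_n=\{\alpha\in A_{n,d+1}:(x_\alpha,t_\alpha)\in U_\pm\}$, let $\mathbb{T}^\pm_n=\big(T_i(x_\alpha,t_\alpha)\big)_{\alpha\in A_n^\pm,\,i\in A_{k,d+1}}$ be the left and right Vandermonde matrices and $\mathbb{W}^\pm_n=\mathrm{diag}(\{\omega_\alpha\}_{\alpha\in A^\pm_n})$ the left and right weight matrices. With the residuals $$\mathfrak{r}^-_n=\mathbb{T}^-_n\theta+\beta-\big(g(x_\alpha,t_\alpha)\big)_{\alpha\in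 A^-_n},\qquad \mathfrak{r}^+_n=\mathbb{T}^+_n\theta-\big(g(x_\alpha,t_\alpha)\big)_{\alpha\in A^+_n},$$ the discrete reconstruction loss is $$\mathcal{L}^n[\theta,\beta,C]=(\mathfrak{r}^-_n)^{\mathsf T}\mathbb{W}^-_n\mathfrak{r}^-_n+(\mathfrak{r}^+_n)^{\mathsf T}\mathbb{W}^+_n\mathfrak{r}^+_n .$$ *Claim.* For every bounded continuous $g:\mathcal{B}\to\mathbb{R}$ (in particular for every $g\in C^0(\overline{\mathcal{B}})$) and all parameters $\theta,\beta,C$, the integrand of $\mathcal{L}[\theta,\beta,C]$ is integrable on $\mathcal{B}$, and $\mathcal{L}^n[\theta,\beta,C]\to\mathcal{L}[\theta,\beta,C]$ as $n\to\infty$. -/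

import Mathlib

noncomputable section

namespace HybridSurrogate

open Polynomial MeasureTheory

/-! ### The Legendre grid -/

/-- The Legendre polynomial of degree `N`, by Rodrigues' formula. -/
def legendre (N : ℕ) : ℝ[X] :=
  C ((2 ^ N * (N.factorial : ℝ))⁻¹) * derivative^[N] ((X ^ 2 - 1) ^ N)

/-- Every derivative of `(X ^ 2 - 1) ^ N` of order `k < N` has at least `k + 2` distinct real
roots: `1`, `-1`, and those given by Rolle's theorem. -/
theorem le_card_roots_iterate_derivative (N k : ℕ) (hk : k < N) :
    k + 2 ≤ (derivative^[k] ((X ^ 2 - 1 : ℝ[X]) ^ N)).roots.toFinset.card := by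
  have hroot : ∀ j < N, ∀ c : ℝ, c ^ 2 = 1 →
      (derivative^[j] ((X ^ 2 - 1 : ℝ[X]) ^ N)).IsRoot c := by
    intro j hj c hc
    have h1 : (X ^ 2 - 1 : ℝ[X]) ∣ derivative^[j] ((X ^ 2 - 1 : ℝ[X]) ^ N) :=
      (dvd_pow_self _ (by omega)).trans (pow_sub_dvd_iterate_derivative_of_pow_dvd j dvd_rfl)
    exact IsRoot.dvd (by simp [IsRoot.def, hc]) h1
  have hne : (1 : ℝ) ≠ -1 := by norm_num
  induction k with
  | zero =>
    have h0 : derivative^[0] ((X ^ 2 - 1 : ℝ[X]) ^ N) ≠ 0 := by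
      simpa using pow_ne_zero N (X_pow_sub_C_ne_zero (by norm_num) (1 : ℝ))
    have hs : ({1, -1} : Finset ℝ) ⊆
        (derivative^[0] ((X ^ 2 - 1 : ℝ[X]) ^ N)).roots.toFinset := by
      intro c hc
      rw [Multiset.mem_toFinset, mem_roots h0]
      refine hroot 0 hk c ?_
      rcases Finset.mem_insert.1 hc with rfl | hc
      · norm_num
      · rw [Finset.mem_singleton.1 hc]; norm_num
    simpa [Finset.card_pair hne] using Finset.card_le_card hs
  | succ k ih =>
    have ih := ih (by omega)
    have hR := card_roots_toFinset_le_card_roots_derivative_sdiff_roots_succ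
      (derivative^[k] ((X ^ 2 - 1 : ℝ[X]) ^ N))
    rw [← Function.iterate_succ_apply' (⇑derivative)] at hR
    set p := derivative^[k] ((X ^ 2 - 1 : ℝ[X]) ^ N) with hp
    set q := derivative^[k + 1] ((X ^ 2 - 1 : ℝ[X]) ^ N) with hq
    have hp0 : p ≠ 0 := by rintro h; simp [h] at ih
    have hq0 : q ≠ 0 := by rintro h; simp [h] at hR; omega
    have hs : ({1, -1} : Finset ℝ) ∪ (q.roots.toFinset \ p.roots.toFinset)
        ⊆ q.roots.toFinset := by
      refine Finset.union_subset ?_ Finset.sdiff_subset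
      intro c hc
      rw [Multiset.mem_toFinset, mem_roots hq0]
      refine hroot _ hk c ?_
      rcases Finset.mem_insert.1 hc with rfl | hc
      · norm_num
      · rw [Finset.mem_singleton.1 hc]; norm_num
    have hd : Disjoint ({1, -1} : Finset ℝ) (q.roots.toFinset \ p.roots.toFinset) := by
      rw [Finset.disjoint_left]
      intro c hc hc2
      refine (Finset.mem_sdiff.1 hc2).2 ?_
      rw [Multiset.mem_toFinset, mem_roots hp0]
      refine hroot _ (by omega) c ?_
      rcases Finset.mem_insert.1 hc with rfl | hc
      · norm_num
      · rw [Finset.mem_singleton.1 hc]; norm_num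
    have h3 := Finset.card_le_card hs
    rw [Finset.card_union_of_disjoint hd, Finset.card_pair hne] at h3
    omega

/-- The Legendre polynomial of degree `n + 1` has exactly `n + 1` distinct real roots. -/
theorem card_roots_legendre (n : ℕ) : (legendre (n + 1)).roots.toFinset.card = n + 1 := by
  have hc : ((2 ^ (n + 1) * ((n + 1).factorial : ℝ))⁻¹) ≠ 0 := by positivity
  rw [legendre, roots_C_mul _ hc]
  apply le_antisymm
  · refine (Multiset.toFinset_card_le _).trans ((card_roots' _).trans
      ((natDegree_iterate_derivative _ _).trans ?_))
    have h2 : (X ^ 2 - 1 : ℝ[X]).natDegree = 2 := natDegree_X_pow_sub_C (r := (1 : ℝ))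
    rw [natDegree_pow, h2]
    omega
  · have h1 := le_card_roots_iterate_derivative (n + 1) n (Nat.lt_succ_self n)
    have hR := card_roots_toFinset_le_card_roots_derivative_sdiff_roots_succ
      (derivative^[n] ((X ^ 2 - 1 : ℝ[X]) ^ (n + 1)))
    rw [← Function.iterate_succ_apply' (⇑derivative)] at hR
    have h3 := Finset.card_le_card (Finset.sdiff_subset
      (s := (derivative^[n + 1] ((X ^ 2 - 1 : ℝ[X]) ^ (n + 1))).roots.toFinset)
      (t := (derivative^[n] ((X ^ 2 - 1 : ℝ[X]) ^ (n + 1))).roots.toFinset))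
    have h4 := hR
    simp only [Nat.succ_eq_add_one] at h4
    omega

/-- The `n + 1` Legendre nodes of degree `n` on `(-1, 1)`: the roots of the Legendre polynomial of
degree `n + 1`, in increasing order. -/
def legendreNode (n : ℕ) : Fin (n + 1) ↪o ℝ :=
  (legendre (n + 1)).roots.toFinset.orderEmbOfFin (card_roots_legendre n)

/-- The Legendre nodes rescaled to `(0, T)`. -/
def timeNode (T : ℝ) (n : ℕ) (j : Fin (n + 1)) : ℝ :=
  T / 2 * (legendreNode n j + 1)

/-- The multi-indices `α ∈ ℕ^d` with `‖α‖_∞ ≤ n`. -/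
abbrev MultiIndex (n d : ℕ) : Type := Fin d → Fin (n + 1)

/-- The space-time points `(x, t)` with `x ∈ ℝ^d`. -/
abbrev SpaceTime (d : ℕ) : Type := (Fin d → ℝ) × ℝ

/-- The spatial domain `Ω = (-1, 1)^d`. -/
def spatialDomain (d : ℕ) : Set (Fin d → ℝ) := {x | ∀ i, x i ∈ Set.Ioo (-1 : ℝ) 1}

/-- The space-time domain `Ω × (0, T)`. -/
def domain (d : ℕ) (T : ℝ) : Set (SpaceTime d) := spatialDomain d ×ˢ Set.Ioo 0 T

/-- The grid point `(x_α, t_α)` of the Legendre grid of degree `n` on `Ω × (0, T)`. -/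
def gridPoint {d : ℕ} (T : ℝ) (n : ℕ) (α : MultiIndex n (d + 1)) : SpaceTime d :=
  (fun i => legendreNode n (α i.castSucc), timeNode T n (α (Fin.last d)))

/-- The tensor-product Lagrange basis polynomial `L_α` of the Legendre grid on `Ω × (0, T)`. -/
def lagrangeBasis {d : ℕ} (T : ℝ) (n : ℕ) (α : MultiIndex n (d + 1)) (p : SpaceTime d) : ℝ :=
  (∏ i : Fin d, (Lagrange.basis Finset.univ (legendreNode n) (α i.castSucc)).eval (p.1 i)) *
    (Lagrange.basis Finset.univ (timeNode T n) (α (Fin.last d))).eval p.2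

/-- The Legendre weight `ω_α = ‖L_α‖²` in `L²(Ω × (0, T))`. -/
def legendreWeight {d : ℕ} (T : ℝ) (n : ℕ) (α : MultiIndex n (d + 1)) : ℝ :=
  ∫ p in domain d T, lagrangeBasis T n α p ^ 2

/-! ### The hybrid surrogate model with one jump -/

/-- The tensor-product Chebyshev polynomial `T_α` on `Ω × (0, T)`; the time variable is rescaled
from `(0, T)` to `(-1, 1)`. -/
def chebyshevBasis {k d : ℕ} (T : ℝ) (α : MultiIndex k (d + 1)) (p : SpaceTime d) : ℝ :=
  (∏ i : Fin d, (Chebyshev.T ℝ ((α i.castSucc : ℕ) : ℤ)).eval (p.1 i)) *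
    (Chebyshev.T ℝ ((α (Fin.last d) : ℕ) : ℤ)).eval (2 * p.2 / T - 1)

/-- The smooth part `Q_θ` of the surrogate. -/
def smoothPart {k d : ℕ} (T : ℝ) (θ : MultiIndex k (d + 1) → ℝ) (p : SpaceTime d) : ℝ :=
  ∑ α, θ α * chebyshevBasis T α p

/-- The polynomial `s̃` parametrizing the approximate shock, with coefficients `C` in the canonical
basis. -/
def shock {m d : ℕ} (C : MultiIndex m d → ℝ) (x : Fin d → ℝ) : ℝ :=
  ∑ α, C α * ∏ i, x i ^ (α i : ℕ)

/-- `U₋`, the points with `t ≤ s̃(x)`. -/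
def leftRegion {m d : ℕ} (C : MultiIndex m d → ℝ) : Set (SpaceTime d) := {p | p.2 ≤ shock C p.1}

/-- `U₊`, the points with `t > s̃(x)`. -/
def rightRegion {m d : ℕ} (C : MultiIndex m d → ℝ) : Set (SpaceTime d) := {p | shock C p.1 < p.2}

/-- The Heaviside function of the approximate shock: `1` on `U₋` and `0` elsewhere. -/
def heaviside {m d : ℕ} (C : MultiIndex m d → ℝ) : SpaceTime d → ℝ :=
  (leftRegion C).indicator 1

/-- The hybrid surrogate model `ψ = Q_θ + β H_s̃`. -/
def hybridSurrogate {k m d : ℕ} (T : ℝ) (θ : MultiIndex k (d + 1) → ℝ) (β : ℝ)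
    (C : MultiIndex m d → ℝ) (p : SpaceTime d) : ℝ :=
  smoothPart T θ p + β * heaviside C p

/-- The continuous reconstruction loss
`∫_Ω ∫_0^T (Q_θ(x,t) + β H_s̃(x,t) - g(x,t))² dt dx`. -/
def loss {k m d : ℕ} (T : ℝ) (g : SpaceTime d → ℝ) (θ : MultiIndex k (d + 1) → ℝ) (β : ℝ)
    (C : MultiIndex m d → ℝ) : ℝ :=
  ∫ x in spatialDomain d, ∫ t in Set.Ioo 0 T, (hybridSurrogate T θ β C (x, t) - g (x, t)) ^ 2

/-! ### The discrete reconstruction loss -/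

/-- The multi-indices of degree `n` whose grid points lie in the region `U`. -/
abbrev RegionIndex {d : ℕ} (T : ℝ) (n : ℕ) (U : Set (SpaceTime d)) : Type :=
  {α : MultiIndex n (d + 1) // gridPoint T n α ∈ U}

instance regionIndexFintype {d : ℕ} (T : ℝ) (n : ℕ) (U : Set (SpaceTime d)) :
    Fintype (RegionIndex T n U) :=
  Fintype.ofFinite _

/-- The Vandermonde matrix of the Chebyshev basis of degree `k` on the grid points in `U`. -/
def vandermonde {d : ℕ} (T : ℝ) (k n : ℕ) (U : Set (SpaceTime d)) :
    Matrix (RegionIndex T n U) (MultiIndex k (d + 1)) ℝ :=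
  Matrix.of fun α i => chebyshevBasis T i (gridPoint T n α.1)

/-- The diagonal matrix of the Legendre weights of the grid points in `U`. -/
def weightMatrix {d : ℕ} (T : ℝ) (n : ℕ) (U : Set (SpaceTime d)) :
    Matrix (RegionIndex T n U) (RegionIndex T n U) ℝ :=
  Matrix.diagonal fun α => legendreWeight T n α.1

/-- The vector of residuals `𝕋 θ + b - g` on the grid points in `U`. -/
def residual {k d : ℕ} (T : ℝ) (g : SpaceTime d → ℝ) (n : ℕ) (U : Set (SpaceTime d))
    (θ : MultiIndex k (d + 1) → ℝ) (b : ℝ) : RegionIndex T n U → ℝ :=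
  (vandermonde T k n U).mulVec θ + (fun _ => b) - fun α => g (gridPoint T n α.1)

/-- The quadratic form `rᵀ 𝕎 r` of the weights of the grid points in `U`. -/
def weightedForm {d : ℕ} (T : ℝ) (n : ℕ) (U : Set (SpaceTime d)) (r : RegionIndex T n U → ℝ) : ℝ :=
  r ⬝ᵥ (weightMatrix T n U).mulVec r

/-- The discrete reconstruction loss on the Legendre grid of degree `n`; the jump height `β` enters
the residual on the left of the shock only. -/
def discreteLoss {k m d : ℕ} (T : ℝ) (g : SpaceTime d → ℝ) (n : ℕ)
    (θ : MultiIndex k (d + 1) → ℝ) (β : ℝ) (C : MultiIndex m d → ℝ) : ℝ :=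
  weightedForm T n (leftRegion C) (residual T g n (leftRegion C) θ β) +
    weightedForm T n (rightRegion C) (residual T g n (rightRegion C) θ 0)

end HybridSurrogate

end

noncomputable section

namespace HybridSurrogate

open Polynomial MeasureTheory

/-! ### Gauss–Legendre quadrature in one variable -/

theorem intervalIntegrable_eval (p : ℝ[X]) (a b : ℝ) :
    IntervalIntegrable (fun x => p.eval x) volume a b :=
  p.continuous.intervalIntegrable a b

theorem integral_eval_derivative_mul (u q : ℝ[X]) (a b : ℝ) :
    ∫ x in a..b, (derivative u * q).eval x =
      (u * q).eval b - (u * q).eval a - ∫ x in a..b, (u * derivative q).eval x := by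
  rw [eq_sub_iff_add_eq, ← intervalIntegral.integral_add (intervalIntegrable_eval _ _ _)
    (intervalIntegrable_eval _ _ _)]
  refine intervalIntegral.integral_eq_sub_of_hasDerivAt (f := fun x => (u * q).eval x)
    (fun x _ => ?_) ((intervalIntegrable_eval _ _ _).add (intervalIntegrable_eval _ _ _))
  simpa only [derivative_mul, eval_add] using (u * q).hasDerivAt x

theorem eval_iterate_derivative_eq_zero {N j : ℕ} (hj : j < N) {c : ℝ} (hc : c ^ 2 = 1) :
    (derivative^[j] ((X ^ 2 - 1 : ℝ[X]) ^ N)).eval c = 0 := by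
  have h1 : (X ^ 2 - 1 : ℝ[X]) ∣ derivative^[j] ((X ^ 2 - 1 : ℝ[X]) ^ N) :=
    (dvd_pow_self _ (by omega)).trans (pow_sub_dvd_iterate_derivative_of_pow_dvd j dvd_rfl)
  exact IsRoot.dvd (by simp [IsRoot.def, hc]) h1

/-- Integrate by parts: `±1` are still roots of the derivatives of order below `N`, so there are no
boundary terms, and each step lowers the degree of `q` until `q = 0`. Keeping `N` fixed while `j`
varies makes the induction close. -/
theorem integral_iterate_derivative_mul_eq_zero (N j : ℕ) (hj : j ≤ N) (q : ℝ[X])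
    (hq : q.degree < j) :
    ∫ x in (-1 : ℝ)..1, (derivative^[j] ((X ^ 2 - 1 : ℝ[X]) ^ N) * q).eval x = 0 := by
  induction j generalizing q with
  | zero =>
    have : q = 0 := by
      rw [← degree_eq_bot]
      exact Nat.WithBot.lt_zero_iff.1 hq
    simp [this]
  | succ j ih =>
    by_cases h0 : q = 0
    · simp [h0]
    have hd : (derivative q).degree < (j : ℕ) := by
      refine (degree_derivative_lt h0).trans_le ?_
      rw [degree_eq_natDegree h0] at hq ⊢
      norm_cast at hq ⊢
      omega
    rw [Function.iterate_succ_apply', integral_eval_derivative_mul, ih (by omega) _ hd,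
      eval_mul, eval_mul, eval_iterate_derivative_eq_zero (by omega) (by norm_num),
      eval_iterate_derivative_eq_zero (by omega) (by norm_num)]
    simp

/-- The Legendre polynomial of degree `N` is orthogonal to all polynomials of degree `< N`. -/
theorem integral_legendre_mul_eq_zero (N : ℕ) (q : ℝ[X]) (hq : q.degree < N) :
    ∫ x in (-1 : ℝ)..1, (legendre N * q).eval x = 0 := by
  have h := integral_iterate_derivative_mul_eq_zero N N le_rfl q hq
  simp only [legendre, mul_assoc, eval_C_mul, intervalIntegral.integral_const_mul] at h ⊢
  rw [h, mul_zero]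

/-- The lower bound comes from counting the distinct roots, which avoids computing a leading
coefficient. -/
theorem degree_legendre_succ (n : ℕ) : (legendre (n + 1)).degree = (n + 1 : ℕ) := by
  have hcard := card_roots_legendre n
  have h0 : legendre (n + 1) ≠ 0 := by
    intro h
    simp [h] at hcard
  rw [degree_eq_natDegree h0]
  congr 1
  apply le_antisymm
  · rw [legendre]
    refine (natDegree_C_mul_le _ _).trans ((natDegree_iterate_derivative _ _).trans ?_)
    have h2 : (X ^ 2 - 1 : ℝ[X]).natDegree = 2 := natDegree_X_pow_sub_C (r := (1 : ℝ))
    rw [natDegree_pow, h2]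
    omega
  · refine hcard.ge.trans ?_
    exact (Multiset.toFinset_card_le _).trans (card_roots' _)

theorem eval_legendre_legendreNode (n : ℕ) (j : Fin (n + 1)) :
    (legendre (n + 1)).eval (legendreNode n j) = 0 := by
  have h := Finset.orderEmbOfFin_mem _ (card_roots_legendre n) j
  rw [Multiset.mem_toFinset] at h
  exact isRoot_of_mem_roots h

/-- The Lagrange basis polynomial of the `j`-th Legendre node. -/
def nodeBasis (n : ℕ) (j : Fin (n + 1)) : ℝ[X] :=
  Lagrange.basis Finset.univ (legendreNode n) j

theorem eval_nodeBasis (n : ℕ) (i j : Fin (n + 1)) :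
    (nodeBasis n i).eval (legendreNode n j) = if i = j then 1 else 0 := by
  split_ifs with h
  · subst h
    exact Lagrange.eval_basis_self (legendreNode n).injective.injOn (Finset.mem_univ _)
  · exact Lagrange.eval_basis_of_ne h (Finset.mem_univ _)

theorem natDegree_nodeBasis (n : ℕ) (j : Fin (n + 1)) : (nodeBasis n j).natDegree = n := by
  rw [nodeBasis, Lagrange.natDegree_basis (legendreNode n).injective.injOn (Finset.mem_univ _)]
  simp

/-- The one-dimensional Gauss–Legendre weight. -/
def nodeWeight (n : ℕ) (j : Fin (n + 1)) : ℝ :=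
  ∫ x in (-1 : ℝ)..1, (nodeBasis n j).eval x ^ 2

/-- Gauss's argument: divide `f` by the Legendre polynomial `P`. The quotient has degree at most
`n`, so its product with `P` integrates to zero; the remainder agrees with `f` at the nodes and
equals its own Lagrange interpolant. -/
theorem integral_eval_eq_sum_integral_nodeBasis (n : ℕ) (f : ℝ[X])
    (hf : f.natDegree ≤ 2 * n + 1) :
    ∫ x in (-1 : ℝ)..1, f.eval x =
      ∑ j, (∫ x in (-1 : ℝ)..1, (nodeBasis n j).eval x) * f.eval (legendreNode n j) := by
  set P := legendre (n + 1) with hP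
  have hPd : P.degree = (n + 1 : ℕ) := degree_legendre_succ n
  have hP0 : P ≠ 0 := by
    rintro h
    rw [h, degree_zero] at hPd
    exact WithBot.bot_ne_coe hPd
  have hdiv : P * (f / P) + f % P = f := EuclideanDomain.div_add_mod f P
  have hq : (f / P).degree < (n + 1 : ℕ) := by
    by_cases h : P.degree ≤ f.degree
    · have h1 := degree_add_div hP0 h
      by_cases hz : f / P = 0
      · rw [hz, degree_zero]; exact WithBot.bot_lt_coe _
      have hf0 : f ≠ 0 := by rintro rfl; simp at hz
      rw [hPd, degree_eq_natDegree hz, degree_eq_natDegree hf0] at h1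
      rw [degree_eq_natDegree hz]
      norm_cast at h1 ⊢
      omega
    · rw [(Polynomial.div_eq_zero_iff hP0).2 (not_le.1 h), degree_zero]; exact WithBot.bot_lt_coe _
  have hr : (f % P).degree < (Finset.univ : Finset (Fin (n + 1))).card := by
    rw [Finset.card_univ, Fintype.card_fin, ← hPd]
    exact EuclideanDomain.mod_lt f hP0
  have hev : ∀ j, f.eval (legendreNode n j) = (f % P).eval (legendreNode n j) := by
    intro j
    conv_lhs => rw [← hdiv]
    rw [eval_add, eval_mul, hP, eval_legendre_legendreNode, zero_mul, zero_add]
  have hint : ∫ x in (-1 : ℝ)..1, f.eval x = ∫ x in (-1 : ℝ)..1, (f % P).eval x := by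
    conv_lhs => rw [← hdiv]
    simp only [eval_add]
    rw [intervalIntegral.integral_add (intervalIntegrable_eval _ _ _)
      (intervalIntegrable_eval _ _ _), integral_legendre_mul_eq_zero _ _ hq, zero_add]
  rw [hint]
  conv_lhs => rw [Lagrange.eq_interpolate (legendreNode n).injective.injOn hr]
  simp only [Lagrange.interpolate_apply, eval_finsetSum, eval_C_mul]
  rw [intervalIntegral.integral_finsetSum
    fun j _ => (intervalIntegrable_eval _ _ _).const_mul _]
  refine Finset.sum_congr rfl fun j _ => ?_
  rw [intervalIntegral.integral_const_mul, mul_comm, hev]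
  rfl

/-- The square of a basis polynomial has degree `2 * n`, within the range of exactness, and its
nodal values are a Kronecker delta. -/
theorem nodeWeight_eq_integral (n : ℕ) (j : Fin (n + 1)) :
    nodeWeight n j = ∫ x in (-1 : ℝ)..1, (nodeBasis n j).eval x := by
  have h := integral_eval_eq_sum_integral_nodeBasis n (nodeBasis n j ^ 2) (by
    rw [natDegree_pow, natDegree_nodeBasis]; omega)
  simpa [eval_pow, eval_nodeBasis, nodeWeight] using h

/-- Gauss–Legendre quadrature is exact for polynomials of degree at most `2 * n + 1`. -/
theorem integral_eval_eq_sum_nodeWeight (n : ℕ) (f : ℝ[X]) (hf : f.natDegree ≤ 2 * n + 1) :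
    ∫ x in (-1 : ℝ)..1, f.eval x = ∑ j, nodeWeight n j * f.eval (legendreNode n j) := by
  simp only [nodeWeight_eq_integral]
  exact integral_eval_eq_sum_integral_nodeBasis n f hf

theorem integral_eval_pos (f : ℝ[X]) (h0 : f ≠ 0)
    (hf : ∀ x ∈ Set.Ioo (-1 : ℝ) 1, 0 ≤ f.eval x) : 0 < ∫ x in (-1 : ℝ)..1, f.eval x := by
  have hcl : ∀ x ∈ Set.Icc (-1 : ℝ) 1, 0 ≤ f.eval x := by
    have hc : IsClosed {x | 0 ≤ f.eval x} := isClosed_le continuous_const f.continuous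
    have := hc.closure_subset_iff.2 (show Set.Ioo (-1 : ℝ) 1 ⊆ _ from hf)
    rwa [closure_Ioo (by norm_num)] at this
  obtain ⟨c, hc, hne⟩ : ∃ c ∈ Set.Icc (-1 : ℝ) 1, f.eval c ≠ 0 := by
    by_contra! h
    exact h0 (eq_zero_of_infinite_isRoot f ((Set.Icc_infinite (by norm_num)).mono h))
  exact intervalIntegral.integral_pos (by norm_num) f.continuous.continuousOn
    (fun x hx => hcl x (Set.Ioc_subset_Icc_self hx)) ⟨c, hc, (hcl c hc).lt_of_ne' hne⟩

/-- The test polynomial `(X - node) * basis ^ 2` has degree `2 * n + 1` and vanishes at every node,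
so its integral is zero. A node outside the interval would give it constant sign there,
contradicting `integral_eval_pos`. -/
theorem legendreNode_mem_Ioo (n : ℕ) (j : Fin (n + 1)) :
    legendreNode n j ∈ Set.Ioo (-1 : ℝ) 1 := by
  have hb0 : nodeBasis n j ≠ 0 := by
    intro h
    have := eval_nodeBasis n j j
    simp [h] at this
  set f : ℝ[X] := (X - C (legendreNode n j)) * nodeBasis n j ^ 2 with hf
  have hf0 : f ≠ 0 := mul_ne_zero (X_sub_C_ne_zero _) (pow_ne_zero _ hb0)
  have hz : ∫ x in (-1 : ℝ)..1, f.eval x = 0 := by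
    rw [integral_eval_eq_sum_nodeWeight n f (by
      refine natDegree_mul_le.trans ?_
      rw [natDegree_X_sub_C, natDegree_pow, natDegree_nodeBasis]
      omega)]
    refine Finset.sum_eq_zero fun i _ => ?_
    by_cases h : j = i
    · subst h; simp [hf]
    · simp [hf, eval_nodeBasis, h]
  constructor
  · by_contra! h
    refine (integral_eval_pos f hf0 fun x hx => ?_).ne' hz
    simp only [hf, eval_mul, eval_sub, eval_X, eval_C, eval_pow]
    exact mul_nonneg (by linarith [hx.1]) (sq_nonneg _)
  · by_contra! h
    have h1 := integral_eval_pos (-f) (neg_ne_zero.2 hf0) fun x hx => by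
      simp only [hf, eval_neg, eval_mul, eval_sub, eval_X, eval_C, eval_pow, ← neg_mul]
      exact mul_nonneg (by linarith [hx.2]) (sq_nonneg _)
    simp only [eval_neg, intervalIntegral.integral_neg, hz, neg_zero, lt_irrefl] at h1

/-! ### Gauss–Legendre quadrature on `Ω × (0, T)` -/

/-- The coordinates of a space-time point, with the time variable rescaled from `(0, T)` to
`(-1, 1)`. -/
def refCoord {d : ℕ} (T : ℝ) (p : SpaceTime d) : Fin (d + 1) → ℝ :=
  Fin.snoc (α := fun _ => ℝ) p.1 (2 * p.2 / T - 1)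

@[simp]
theorem refCoord_castSucc {d : ℕ} (T : ℝ) (p : SpaceTime d) (i : Fin d) :
    refCoord T p i.castSucc = p.1 i := by
  simp [refCoord]

@[simp]
theorem refCoord_last {d : ℕ} (T : ℝ) (p : SpaceTime d) :
    refCoord T p (Fin.last d) = 2 * p.2 / T - 1 := by
  simp [refCoord]

theorem refCoord_gridPoint {d : ℕ} {T : ℝ} (hT : 0 < T) (n : ℕ) (α : MultiIndex n (d + 1))
    (i : Fin (d + 1)) : refCoord T (gridPoint T n α) i = legendreNode n (α i) := by
  refine Fin.lastCases ?_ (fun i => ?_) i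
  · rw [refCoord_last, gridPoint, timeNode]
    field_simp
    ring
  · rw [refCoord_castSucc, gridPoint]

theorem continuous_refCoord_apply {d : ℕ} (T : ℝ) (i : Fin (d + 1)) :
    Continuous fun p : SpaceTime d => refCoord T p i := by
  refine Fin.lastCases ?_ (fun i => ?_) i
  · simp only [refCoord_last]
    fun_prop
  · simp only [refCoord_castSucc]
    fun_prop

theorem gridPoint_mem_domain {d : ℕ} {T : ℝ} (hT : 0 < T) (n : ℕ) (α : MultiIndex n (d + 1)) :
    gridPoint T n α ∈ domain d T := by
  refine ⟨fun i => legendreNode_mem_Ioo n _, ?_⟩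
  have h := legendreNode_mem_Ioo n (α (Fin.last d))
  simp only [gridPoint, timeNode]
  constructor
  · nlinarith [h.1]
  · nlinarith [h.2]

theorem spatialDomain_eq_pi (d : ℕ) :
    spatialDomain d = Set.univ.pi fun _ => Set.Ioo (-1 : ℝ) 1 := by
  ext x
  simp [spatialDomain]

theorem isOpen_domain (d : ℕ) (T : ℝ) : IsOpen (domain d T) := by
  rw [domain, spatialDomain_eq_pi]
  exact (isOpen_set_pi Set.finite_univ fun _ _ => isOpen_Ioo).prod isOpen_Ioo

/-- A compact box that contains the space-time domain. -/
def closedDomain (d : ℕ) (T : ℝ) : Set (SpaceTime d) :=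
  (Set.univ.pi fun _ => Set.Icc (-1 : ℝ) 1) ×ˢ Set.Icc 0 T

theorem isCompact_closedDomain (d : ℕ) (T : ℝ) : IsCompact (closedDomain d T) :=
  (isCompact_univ_pi fun _ => isCompact_Icc).prod isCompact_Icc

theorem domain_subset_closedDomain (d : ℕ) (T : ℝ) : domain d T ⊆ closedDomain d T := by
  rw [domain, spatialDomain_eq_pi]
  exact Set.prod_mono (Set.pi_mono fun _ _ => Set.Ioo_subset_Icc_self) Set.Ioo_subset_Icc_self

theorem volume_domain_lt_top (d : ℕ) (T : ℝ) : volume (domain d T) < ⊤ :=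
  (measure_mono (domain_subset_closedDomain d T)).trans_lt
    (isCompact_closedDomain d T).measure_lt_top

/-- Fubini; `T / 2` is the Jacobian of the time rescaling. -/
theorem integral_domain_prod {d : ℕ} {T : ℝ} (hT : 0 < T) (f : Fin (d + 1) → ℝ → ℝ) :
    ∫ p in domain d T, ∏ i, f i (refCoord T p i) =
      T / 2 * ∏ i, ∫ x in (-1 : ℝ)..1, f i x := by
  have hIoo : ∀ (a b : ℝ) (_ : a ≤ b) (u : ℝ → ℝ),
      ∫ x in Set.Ioo a b, u x = ∫ x in a..b, u x := fun a b hab u => by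
    rw [intervalIntegral.integral_of_le hab, integral_Ioc_eq_integral_Ioo]
  simp only [Fin.prod_univ_castSucc, refCoord_castSucc, refCoord_last]
  rw [domain, Measure.volume_eq_prod,
    setIntegral_prod_mul (fun x : Fin d → ℝ => ∏ i, f i.castSucc (x i))
      (fun t => f (Fin.last d) (2 * t / T - 1)),
    spatialDomain_eq_pi, volume_pi, Measure.restrict_pi_pi,
    integral_fintype_prod_eq_prod (fun i : Fin d => f i.castSucc), hIoo 0 T hT.le]
  simp only [hIoo (-1) 1 (by norm_num)]
  have ht : ∫ t in (0 : ℝ)..T, f (Fin.last d) (2 * t / T - 1) =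
      T / 2 * ∫ x in (-1 : ℝ)..1, f (Fin.last d) x := by
    have h := intervalIntegral.integral_comp_mul_sub (a := 0) (b := T) (f (Fin.last d))
      (show 2 / T ≠ 0 by positivity) 1
    rw [mul_zero, zero_sub, div_mul_cancel₀ _ hT.ne', inv_div, smul_eq_mul,
      show (2 : ℝ) - 1 = 1 by norm_num] at h
    rw [← h]
    simp only [div_mul_eq_mul_div]
  rw [ht]
  ring

theorem eval_basis_timeNode {T : ℝ} (hT : 0 < T) (n : ℕ) (j : Fin (n + 1)) (t : ℝ) :
    (Lagrange.basis Finset.univ (timeNode T n) j).eval t =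
      (nodeBasis n j).eval (2 * t / T - 1) := by
  simp only [nodeBasis, Lagrange.basis, eval_prod]
  refine Finset.prod_congr rfl fun i _ => ?_
  simp only [Lagrange.basisDivisor, eval_mul, eval_C, eval_sub, eval_X, timeNode]
  rw [show T / 2 * (legendreNode n j + 1) - T / 2 * (legendreNode n i + 1) =
      T / 2 * (legendreNode n j - legendreNode n i) by ring, mul_inv]
  field_simp
  ring

theorem lagrangeBasis_eq_prod {d : ℕ} {T : ℝ} (hT : 0 < T) (n : ℕ) (α : MultiIndex n (d + 1))
    (p : SpaceTime d) :
    lagrangeBasis T n α p = ∏ i, (nodeBasis n (α i)).eval (refCoord T p i) := by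
  rw [lagrangeBasis, Fin.prod_univ_castSucc, eval_basis_timeNode hT, refCoord_last]
  simp only [refCoord_castSucc, nodeBasis]

theorem legendreWeight_eq_prod {d : ℕ} {T : ℝ} (hT : 0 < T) (n : ℕ) (α : MultiIndex n (d + 1)) :
    legendreWeight T n α = T / 2 * ∏ i, nodeWeight n (α i) := by
  simp only [legendreWeight, lagrangeBasis_eq_prod hT, ← Finset.prod_pow]
  exact integral_domain_prod hT fun i x => (nodeBasis n (α i)).eval x ^ 2

theorem legendreWeight_nonneg {d : ℕ} (T : ℝ) (n : ℕ) (α : MultiIndex n (d + 1)) :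
    0 ≤ legendreWeight T n α :=
  integral_nonneg fun _ => sq_nonneg _

/-- The quadrature rule is exact for tensor-product monomials of degree at most `2 * n + 1` in each
variable. -/
theorem sum_legendreWeight_mul_prod_pow {d : ℕ} {T : ℝ} (hT : 0 < T) (n : ℕ) (a : Fin (d + 1) → ℕ)
    (ha : ∀ i, a i ≤ 2 * n + 1) :
    ∑ α : MultiIndex n (d + 1),
        legendreWeight T n α * ∏ i, refCoord T (gridPoint T n α) i ^ a i =
      ∫ p in domain d T, ∏ i, refCoord T p i ^ a i := by
  rw [integral_domain_prod hT fun i x => x ^ a i]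
  have h1 : ∀ i, ∫ x in (-1 : ℝ)..1, x ^ a i =
      ∑ j, nodeWeight n j * legendreNode n j ^ a i := fun i => by
    simpa using integral_eval_eq_sum_nodeWeight n (X ^ a i) (by simpa using ha i)
  simp only [h1, Finset.prod_univ_sum, Fintype.piFinset_univ, Finset.mul_sum,
    legendreWeight_eq_prod hT, refCoord_gridPoint hT, Finset.prod_mul_distrib, mul_assoc]

theorem sum_legendreWeight {d : ℕ} {T : ℝ} (hT : 0 < T) (n : ℕ) :
    ∑ α : MultiIndex n (d + 1), legendreWeight T n α = volume.real (domain d T) := by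
  simpa using sum_legendreWeight_mul_prod_pow (d := d) hT n (fun _ => 0) (by simp)

/-! ### Convergence on continuous functions -/

section Convergence

open Filter Topology

theorem integrableOn_domain_of_continuous {d : ℕ} (T : ℝ) {f : SpaceTime d → ℝ}
    (hf : Continuous f) : IntegrableOn f (domain d T) :=
  (hf.continuousOn.integrableOn_compact (isCompact_closedDomain d T)).mono_set
    (domain_subset_closedDomain d T)

theorem continuous_eval_refCoord {d : ℕ} (T : ℝ) (q : MvPolynomial (Fin (d + 1)) ℝ) :
    Continuous fun p : SpaceTime d => MvPolynomial.eval (refCoord T p) q :=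
  (MvPolynomial.continuous_eval q).comp (continuous_pi (continuous_refCoord_apply T))

theorem sum_legendreWeight_mul_eval {d : ℕ} {T : ℝ} (hT : 0 < T)
    (q : MvPolynomial (Fin (d + 1)) ℝ) (n : ℕ) (hn : q.totalDegree ≤ n) :
    ∑ α : MultiIndex n (d + 1),
        legendreWeight T n α * MvPolynomial.eval (refCoord T (gridPoint T n α)) q =
      ∫ p in domain d T, MvPolynomial.eval (refCoord T p) q := by
  simp only [MvPolynomial.eval_eq', Finset.mul_sum]
  rw [Finset.sum_comm, integral_finsetSum]
  · refine Finset.sum_congr rfl fun a ha => ?_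
    rw [integral_const_mul, ← sum_legendreWeight_mul_prod_pow hT n a, Finset.mul_sum]
    · refine Finset.sum_congr rfl fun α _ => ?_
      ring
    · intro i
      have h1 : a i ≤ a.degree := Finsupp.le_degree i a
      have h2 := MvPolynomial.le_totalDegree ha
      rw [Finsupp.degree_eq_sum] at h1
      rw [Finsupp.sum_fintype _ _ (fun _ => rfl)] at h2
      omega
  · intro a _
    refine integrableOn_domain_of_continuous T (continuous_const.mul ?_)
    exact continuous_finsetProd _ fun i _ => (continuous_refCoord_apply T i).pow _

/-- Stone–Weierstrass for the algebra generated by the rescaled coordinates, which separate points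
because `T ≠ 0`. -/
theorem exists_mvPolynomial_near {d : ℕ} {T : ℝ} (hT : 0 < T) {f : SpaceTime d → ℝ}
    (hf : Continuous f) {ε : ℝ} (hε : 0 < ε) :
    ∃ q : MvPolynomial (Fin (d + 1)) ℝ,
      ∀ p ∈ closedDomain d T, |MvPolynomial.eval (refCoord T p) q - f p| < ε := by
  let c : Fin (d + 1) → C(SpaceTime d, ℝ) := fun i => ⟨_, continuous_refCoord_apply T i⟩
  let A : Subalgebra ℝ C(SpaceTime d, ℝ) := (MvPolynomial.aeval c).range
  have hev : ∀ (q : MvPolynomial (Fin (d + 1)) ℝ) p,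
      MvPolynomial.aeval c q p = MvPolynomial.eval (refCoord T p) q := by
    intro q p
    induction q using MvPolynomial.induction_on with
    | C a => simp
    | add q r hq hr => simp [hq, hr]
    | mul_X q i hq => simp [hq, c]
  have hA : A.SeparatesPoints := by
    intro x y hxy
    obtain ⟨i, hi⟩ : ∃ i, refCoord T x i ≠ refCoord T y i := by
      by_contra! h
      refine hxy (Prod.ext (funext fun i => ?_) ?_)
      · simpa using h i.castSucc
      · have h := h (Fin.last d)
        rw [refCoord_last, refCoord_last] at h
        field_simp at h
        linarith
    exact ⟨_, ⟨c i, ⟨MvPolynomial.X i, by simp⟩, rfl⟩, hi⟩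
  obtain ⟨g, ⟨q, rfl⟩, hg⟩ :=
    ContinuousMap.exists_mem_subalgebra_near_continuous_of_isCompact_of_separatesPoints hA
      ⟨f, hf⟩ (isCompact_closedDomain d T) hε
  refine ⟨q, fun p hp => ?_⟩
  have h := hg p hp
  rw [← hev]
  exact h

/-- Gauss–Legendre quadrature on `Ω × (0, T)` converges for continuous functions. -/
theorem tendsto_sum_legendreWeight_mul {d : ℕ} {T : ℝ} (hT : 0 < T) {f : SpaceTime d → ℝ}
    (hf : Continuous f) :
    Tendsto (fun n => ∑ α : MultiIndex n (d + 1), legendreWeight T n α * f (gridPoint T n α))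
      atTop (𝓝 (∫ p in domain d T, f p)) := by
  rw [Metric.tendsto_atTop]
  intro ε hε
  set V := volume.real (domain d T) with hV
  have hV0 : 0 ≤ V := measureReal_nonneg
  -- Sum and integral each contribute an error of at most `δ * V`; the `+ 1` makes the total
  -- strictly less than `ε` and keeps the denominator positive.
  set δ := ε / (2 * V + 1) with hδ
  have hδ0 : 0 < δ := by positivity
  obtain ⟨q, hq⟩ := exists_mvPolynomial_near hT hf hδ0
  refine ⟨q.totalDegree, fun n hn => ?_⟩
  have h1 := sum_legendreWeight_mul_eval hT q n hn
  have h2 : |∑ α : MultiIndex n (d + 1),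
        legendreWeight T n α * MvPolynomial.eval (refCoord T (gridPoint T n α)) q -
      ∑ α : MultiIndex n (d + 1), legendreWeight T n α * f (gridPoint T n α)| ≤ δ * V := by
    rw [← Finset.sum_sub_distrib, hV, ← sum_legendreWeight hT n, Finset.mul_sum]
    refine (Finset.abs_sum_le_sum_abs _ _).trans (Finset.sum_le_sum fun α _ => ?_)
    rw [← mul_sub, abs_mul, abs_of_nonneg (legendreWeight_nonneg T n α), mul_comm]
    exact mul_le_mul_of_nonneg_right
      (hq _ (domain_subset_closedDomain d T (gridPoint_mem_domain hT n α))).le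
      (legendreWeight_nonneg T n α)
  have h3 : |(∫ p in domain d T, MvPolynomial.eval (refCoord T p) q) -
      ∫ p in domain d T, f p| ≤ δ * V := by
    rw [← integral_sub (integrableOn_domain_of_continuous T (continuous_eval_refCoord T q))
      (integrableOn_domain_of_continuous T hf)]
    exact norm_setIntegral_le_of_norm_le_const
      (f := fun p => MvPolynomial.eval (refCoord T p) q - f p) (volume_domain_lt_top d T)
      fun p hp => (hq p (domain_subset_closedDomain d T hp)).le
  have h4 : δ * (2 * V + 1) = ε := div_mul_cancel₀ _ (by positivity)
  rw [Real.dist_eq, abs_lt]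
  rw [abs_le] at h2 h3
  constructor <;> linarith [h2.1, h2.2, h3.1, h3.2]

end Convergence

/-! ### Quadrature rules and functions with a null set of discontinuities -/

open Filter Topology in
/-- If a sequence of quadrature rules with nonnegative weights converges on all bounded continuous
functions, then it converges on all bounded functions that are continuous off a closed null set. -/
theorem tendsto_quadrature_of_continuousOn_compl {X : Type*} [PseudoMetricSpace X]
    [MeasurableSpace X] [BorelSpace X] {μ : Measure X} [IsFiniteMeasure μ]
    {ι : ℕ → Type*} [∀ n, Fintype (ι n)] {w : ∀ n, ι n → ℝ} {x : ∀ n, ι n → X}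
    (hw : ∀ n i, 0 ≤ w n i)
    (hconv : ∀ f : X → ℝ, Continuous f → (∃ M, ∀ p, |f p| ≤ M) →
      Tendsto (fun n => ∑ i, w n i * f (x n i)) atTop (𝓝 (∫ p, f p ∂μ)))
    {K : Set X} (hK : IsClosed K) (hKn : K.Nonempty) (hK0 : μ K = 0)
    {h : X → ℝ} {M : ℝ} (hM : ∀ p, |h p| ≤ M) (hc : ContinuousOn h Kᶜ) :
    Tendsto (fun n => ∑ i, w n i * h (x n i)) atTop (𝓝 (∫ p, h p ∂μ)) := by
  -- Cutoffs that vanish on `K` and are eventually `1` at each point off `K`. Nonemptiness of `K`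
  -- matters: `Metric.infDist` to the empty set is `0`.
  let φ : ℕ → X → ℝ := fun j p => min 1 (j * Metric.infDist p K)
  have hφc : ∀ j, Continuous (φ j) := fun j =>
    continuous_const.min (continuous_const.mul (Metric.continuous_infDist_pt K))
  have hφ0 : ∀ j p, 0 ≤ φ j p := fun j p =>
    le_min zero_le_one (mul_nonneg j.cast_nonneg Metric.infDist_nonneg)
  have hφ1 : ∀ j p, φ j p ≤ 1 := fun j p => min_le_left _ _
  have hφh : ∀ j, Continuous fun p => φ j p * h p := by
    intro j
    refine continuous_iff_continuousAt.2 fun p => ?_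
    -- On `K` the bound `φ j * M` squeezes the product to zero, whatever `h` does there.
    by_cases hp : p ∈ K
    · have hp0 : φ j p = 0 := by simp [φ, Metric.infDist_zero_of_mem hp]
      rw [ContinuousAt, hp0, zero_mul]
      refine squeeze_zero_norm (a := fun q => φ j q * M) (fun q => ?_) ?_
      · rw [norm_mul, Real.norm_of_nonneg (hφ0 j q)]
        exact mul_le_mul_of_nonneg_left (hM q) (hφ0 j q)
      · simpa [hp0] using ((hφc j).tendsto p).mul_const M
    · exact (hφc j).continuousAt.mul (hc.continuousAt (hK.isOpen_compl.mem_nhds hp))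
  have hlim : ∀ p ∉ K, Tendsto (fun j => φ j p) atTop (𝓝 1) := by
    intro p hp
    have hd : 0 < Metric.infDist p K := (hK.notMem_iff_infDist_pos hKn).1 hp
    refine tendsto_const_nhds.congr' ?_
    filter_upwards [(tendsto_natCast_atTop_atTop.atTop_mul_const hd).eventually_ge_atTop 1]
      with j hj
    exact (min_eq_left hj).symm
  have hKae : ∀ᵐ p ∂μ, p ∉ K := measure_eq_zero_iff_ae_notMem.1 hK0
  have hφi : ∀ j, Integrable (φ j) μ := fun j =>
    Integrable.of_bound (hφc j).aestronglyMeasurable 1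
      (ae_of_all _ fun p => by rw [Real.norm_of_nonneg (hφ0 j p)]; exact hφ1 j p)
  -- Measurability is not assumed: `h` is an a.e. limit of the continuous products.
  have hhm : AEStronglyMeasurable h μ := by
    refine aestronglyMeasurable_of_tendsto_ae (u := atTop) (f := fun j p => φ j p * h p)
      (fun j => (hφh j).aestronglyMeasurable) ?_
    filter_upwards [hKae] with p hp
    simpa using (hlim p hp).mul_const (h p)
  have hhi : Integrable h μ := Integrable.of_bound hhm M (ae_of_all _ hM)
  have hφhi : ∀ j, Integrable (fun p => φ j p * h p) μ := fun j =>
    hhi.bdd_mul (hφc j).aestronglyMeasurable (c := 1)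
      (ae_of_all _ fun p => by rw [Real.norm_of_nonneg (hφ0 j p)]; exact hφ1 j p)
  have hone : Tendsto (fun j => ∫ p, (1 - φ j p) ∂μ) atTop (𝓝 0) := by
    have := tendsto_integral_of_dominated_convergence (μ := μ) (F := fun j p => 1 - φ j p)
      (f := fun _ => 0) (fun _ => 1)
      (fun j => (continuous_const.sub (hφc j)).aestronglyMeasurable) (integrable_const 1)
      (fun j => ae_of_all _ fun p => by
        rw [Real.norm_of_nonneg (sub_nonneg.2 (hφ1 j p))]
        linarith [hφ0 j p])
      (by
        filter_upwards [hKae] with p hp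
        simpa using (hlim p hp).const_sub 1)
    simpa using this
  rw [Metric.tendsto_atTop']
  intro ε hε
  -- With `j` fixed before `n`, three errors below `ε / 4` remain: truncation in the sum, quadrature
  -- of `φ j * h`, truncation in the integral.
  obtain ⟨j, hj⟩ : ∃ j, M * ∫ p, (1 - φ j p) ∂μ < ε / 4 := by
    have : Tendsto (fun j => M * ∫ p, (1 - φ j p) ∂μ) atTop (𝓝 0) := by
      simpa using hone.const_mul M
    exact (this.eventually_lt_const (by positivity)).exists
  have hA := hconv _ (hφh j) ⟨M, fun p => by
    rw [abs_mul, abs_of_nonneg (hφ0 j p)]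
    exact (mul_le_of_le_one_left (abs_nonneg _) (hφ1 j p)).trans (hM p)⟩
  have hB := (hconv (fun p => 1 - φ j p) (continuous_const.sub (hφc j)) ⟨1, fun p => by
    rw [abs_of_nonneg (sub_nonneg.2 (hφ1 j p))]
    linarith [hφ0 j p]⟩).const_mul M
  obtain ⟨N, hN⟩ := eventually_atTop.1
    ((hA.eventually (Metric.ball_mem_nhds _ (show 0 < ε / 4 by positivity))).and
      (hB.eventually_lt_const hj))
  refine ⟨N, fun n hn => ?_⟩
  obtain ⟨h1, h2⟩ := hN n hn.le
  rw [Real.dist_eq] at h1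
  rw [Real.dist_eq]
  have hpt : ∀ p, |h p - φ j p * h p| ≤ M * (1 - φ j p) := by
    intro p
    rw [show h p - φ j p * h p = h p * (1 - φ j p) by ring, abs_mul,
      abs_of_nonneg (sub_nonneg.2 (hφ1 j p))]
    exact mul_le_mul_of_nonneg_right (hM p) (sub_nonneg.2 (hφ1 j p))
  have h3 : |∑ i, w n i * h (x n i) - ∑ i, w n i * (φ j (x n i) * h (x n i))| ≤
      M * ∑ i, w n i * (1 - φ j (x n i)) := by
    rw [← Finset.sum_sub_distrib, Finset.mul_sum]
    refine (Finset.abs_sum_le_sum_abs _ _).trans (Finset.sum_le_sum fun i _ => ?_)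
    rw [← mul_sub, abs_mul, abs_of_nonneg (hw n i), mul_left_comm]
    exact mul_le_mul_of_nonneg_left (hpt _) (hw n i)
  have h4 : |(∫ p, h p ∂μ) - ∫ p, φ j p * h p ∂μ| ≤ M * ∫ p, (1 - φ j p) ∂μ := by
    rw [← integral_sub hhi (hφhi j), ← integral_const_mul]
    exact norm_integral_le_of_norm_le (f := fun p => h p - φ j p * h p)
      (g := fun p => M * (1 - φ j p)) (((integrable_const 1).sub (hφi j)).const_mul M) (ae_of_all _ hpt)
  rw [abs_lt] at h1 ⊢
  rw [abs_le] at h3 h4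
  constructor <;> linarith [h1.1, h1.2, h3.1, h3.2, h4.1, h4.2]

/-! ### Regularity of the surrogate -/

theorem continuous_smoothPart {k d : ℕ} (T : ℝ) (θ : MultiIndex k (d + 1) → ℝ) :
    Continuous (smoothPart T θ) := by
  unfold smoothPart chebyshevBasis
  refine continuous_finsetSum _ fun α _ => continuous_const.mul (Continuous.mul ?_ ?_)
  · exact continuous_finsetProd _ fun i _ => (Polynomial.continuous _).comp (by fun_prop)
  · exact (Polynomial.continuous _).comp (by fun_prop)

theorem continuous_shock {m d : ℕ} (C : MultiIndex m d → ℝ) : Continuous (shock C) := by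
  unfold shock
  fun_prop

theorem isClosed_leftRegion {m d : ℕ} (C : MultiIndex m d → ℝ) : IsClosed (leftRegion C) :=
  isClosed_le continuous_snd ((continuous_shock C).comp continuous_fst)

/-- The graph of the approximate shock. -/
def shockGraph {m d : ℕ} (C : MultiIndex m d → ℝ) : Set (SpaceTime d) :=
  {p | p.2 = shock C p.1}

theorem isClosed_shockGraph {m d : ℕ} (C : MultiIndex m d → ℝ) : IsClosed (shockGraph C) :=
  isClosed_eq continuous_snd ((continuous_shock C).comp continuous_fst)

/-- Every slice at fixed `x` is a single point. -/
theorem volume_shockGraph {m d : ℕ} (C : MultiIndex m d → ℝ) : volume (shockGraph C) = 0 := by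
  rw [Measure.volume_eq_prod, Measure.measure_prod_null (isClosed_shockGraph C).measurableSet]
  refine Filter.Eventually.of_forall fun x => ?_
  have : Prod.mk x ⁻¹' shockGraph C = {shock C x} := by
    ext t
    simp [shockGraph]
  simp [this]

theorem continuousOn_heaviside {m d : ℕ} (C : MultiIndex m d → ℝ) :
    ContinuousOn (heaviside C) (shockGraph C)ᶜ := by
  intro p hp
  refine ContinuousAt.continuousWithinAt ?_
  rcases lt_or_gt_of_ne (show p.2 ≠ shock C p.1 from hp) with h | h
  · have ho : IsOpen {q : SpaceTime d | q.2 < shock C q.1} :=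
      isOpen_lt continuous_snd ((continuous_shock C).comp continuous_fst)
    refine continuousAt_const.congr (f := fun _ => (1 : ℝ)) ?_
    filter_upwards [ho.mem_nhds h] with q hq
    have hq' : q ∈ leftRegion C := le_of_lt hq
    simp [heaviside, hq']
  · refine continuousAt_const.congr (f := fun _ => (0 : ℝ)) ?_
    filter_upwards [(isClosed_leftRegion C).isOpen_compl.mem_nhds
      (show p ∈ (leftRegion C)ᶜ from not_le.2 h)] with q hq
    exact (Set.indicator_of_notMem hq (1 : SpaceTime d → ℝ)).symm

theorem measurable_hybridSurrogate {k m d : ℕ} (T : ℝ) (θ : MultiIndex k (d + 1) → ℝ) (β : ℝ)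
    (C : MultiIndex m d → ℝ) : Measurable (hybridSurrogate T θ β C) :=
  (continuous_smoothPart T θ).measurable.add
    ((measurable_one.indicator (isClosed_leftRegion C).measurableSet).const_mul β)

theorem continuousOn_hybridSurrogate {k m d : ℕ} (T : ℝ) (θ : MultiIndex k (d + 1) → ℝ) (β : ℝ)
    (C : MultiIndex m d → ℝ) : ContinuousOn (hybridSurrogate T θ β C) (shockGraph C)ᶜ :=
  (continuous_smoothPart T θ).continuousOn.add
    (continuousOn_const.mul (continuousOn_heaviside C))

theorem hybridSurrogate_of_mem {k m d : ℕ} (T : ℝ) (θ : MultiIndex k (d + 1) → ℝ) (β : ℝ)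
    {C : MultiIndex m d → ℝ} {p : SpaceTime d} (hp : p ∈ leftRegion C) :
    hybridSurrogate T θ β C p = smoothPart T θ p + β := by
  simp [hybridSurrogate, heaviside, hp]

theorem hybridSurrogate_of_notMem {k m d : ℕ} (T : ℝ) (θ : MultiIndex k (d + 1) → ℝ) (β : ℝ)
    {C : MultiIndex m d → ℝ} {p : SpaceTime d} (hp : p ∉ leftRegion C) :
    hybridSurrogate T θ β C p = smoothPart T θ p := by
  simp [hybridSurrogate, heaviside, hp]

theorem exists_abs_hybridSurrogate_le {k m d : ℕ} (T : ℝ) (θ : MultiIndex k (d + 1) → ℝ) (β : ℝ)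
    (C : MultiIndex m d → ℝ) : ∃ B, ∀ p ∈ domain d T, |hybridSurrogate T θ β C p| ≤ B := by
  obtain ⟨B, hB⟩ := (isCompact_closedDomain d T).exists_bound_of_continuousOn
    (continuous_smoothPart T θ).continuousOn
  refine ⟨B + |β|, fun p hp => ?_⟩
  have h : |smoothPart T θ p| ≤ B := hB p (domain_subset_closedDomain d T hp)
  by_cases hC : p ∈ leftRegion C
  · rw [hybridSurrogate_of_mem T θ β hC]
    exact (abs_add_le _ _).trans (by linarith)
  · rw [hybridSurrogate_of_notMem T θ β hC]
    linarith [abs_nonneg β]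

/-! ### The reconstruction losses -/

instance isFiniteMeasure_restrict_domain (d : ℕ) (T : ℝ) :
    IsFiniteMeasure (volume.restrict (domain d T)) :=
  ⟨by simpa using volume_domain_lt_top d T⟩

theorem weightedForm_residual {k d : ℕ} (T : ℝ) (g : SpaceTime d → ℝ) (n : ℕ)
    (U : Set (SpaceTime d)) (θ : MultiIndex k (d + 1) → ℝ) (b : ℝ) :
    weightedForm T n U (residual T g n U θ b) =
      ∑ α : RegionIndex T n U, legendreWeight T n α.1 *
        (smoothPart T θ (gridPoint T n α.1) + b - g (gridPoint T n α.1)) ^ 2 := by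
  simp only [weightedForm, weightMatrix, dotProduct, Matrix.mulVec_diagonal]
  refine Finset.sum_congr rfl fun α _ => ?_
  have h : residual T g n U θ b α =
      smoothPart T θ (gridPoint T n α.1) + b - g (gridPoint T n α.1) := by
    simp [residual, vandermonde, Matrix.mulVec, dotProduct, smoothPart, mul_comm]
  rw [h]
  ring

/-- The discrete loss is the Gauss–Legendre quadrature of the integrand of the continuous loss. -/
theorem discreteLoss_eq_sum {k m d : ℕ} (T : ℝ) (g : SpaceTime d → ℝ) (n : ℕ)
    (θ : MultiIndex k (d + 1) → ℝ) (β : ℝ) (C : MultiIndex m d → ℝ) :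
    discreteLoss T g n θ β C =
      ∑ α : MultiIndex n (d + 1), legendreWeight T n α *
        (hybridSurrogate T θ β C (gridPoint T n α) - g (gridPoint T n α)) ^ 2 := by
  classical
  have hsub : ∀ (U : Set (SpaceTime d)) (F : MultiIndex n (d + 1) → ℝ),
      ∑ α : RegionIndex T n U, F α.1 =
        ∑ α : MultiIndex n (d + 1), if gridPoint T n α ∈ U then F α else 0 := by
    intro U F
    rw [← Finset.sum_filter]
    exact (Finset.sum_subtype _ (fun α => by simp) F).symm
  rw [discreteLoss, weightedForm_residual, weightedForm_residual,
    hsub (leftRegion C) fun α => legendreWeight T n α *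
      (smoothPart T θ (gridPoint T n α) + β - g (gridPoint T n α)) ^ 2,
    hsub (rightRegion C) fun α => legendreWeight T n α *
      (smoothPart T θ (gridPoint T n α) + 0 - g (gridPoint T n α)) ^ 2,
    ← Finset.sum_add_distrib]
  refine Finset.sum_congr rfl fun α _ => ?_
  by_cases h : gridPoint T n α ∈ leftRegion C
  · have h' : gridPoint T n α ∉ rightRegion C := by
      simpa [leftRegion, rightRegion] using h
    rw [if_pos h, if_neg h', add_zero, hybridSurrogate_of_mem T θ β h]
  · have h' : gridPoint T n α ∈ rightRegion C := by
      simpa [leftRegion, rightRegion] using h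
    rw [if_neg h, if_pos h', zero_add, add_zero, hybridSurrogate_of_notMem T θ β h]

theorem exists_sq_sub_le {k m d : ℕ} (T : ℝ) (θ : MultiIndex k (d + 1) → ℝ) (β : ℝ)
    (C : MultiIndex m d → ℝ) {g : SpaceTime d → ℝ} (hgb : ∃ M : ℝ, ∀ p ∈ domain d T, |g p| ≤ M) :
    ∃ B, 0 ≤ B ∧ ∀ p ∈ domain d T, |(hybridSurrogate T θ β C p - g p) ^ 2| ≤ B := by
  obtain ⟨M, hM⟩ := hgb
  obtain ⟨B, hB⟩ := exists_abs_hybridSurrogate_le T θ β C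
  refine ⟨(B + M) ^ 2, sq_nonneg _, fun p hp => ?_⟩
  rw [abs_pow]
  exact pow_le_pow_left₀ (abs_nonneg _)
    ((abs_sub _ _).trans (add_le_add (hB p hp) (hM p hp))) 2

theorem integrableOn_sq_sub {k m d : ℕ} (T : ℝ) (θ : MultiIndex k (d + 1) → ℝ) (β : ℝ)
    (C : MultiIndex m d → ℝ) {g : SpaceTime d → ℝ} (hg : ContinuousOn g (domain d T))
    (hgb : ∃ M : ℝ, ∀ p ∈ domain d T, |g p| ≤ M) :
    IntegrableOn (fun p => (hybridSurrogate T θ β C p - g p) ^ 2) (domain d T) := by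
  obtain ⟨B, -, hB⟩ := exists_sq_sub_le T θ β C hgb
  have hD := (isOpen_domain d T).measurableSet
  refine Integrable.of_bound (C := B) ?_ ?_
  · exact ((measurable_hybridSurrogate T θ β C).aestronglyMeasurable.sub
      (hg.aestronglyMeasurable hD)).pow 2
  · exact (ae_restrict_iff' hD).2 (ae_of_all _ hB)

open Filter Topology in
theorem tendsto_discreteLoss {k m d : ℕ} {T : ℝ} (hT : 0 < T) (θ : MultiIndex k (d + 1) → ℝ)
    (β : ℝ) (C : MultiIndex m d → ℝ) {g : SpaceTime d → ℝ} (hg : ContinuousOn g (domain d T))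
    (hgb : ∃ M : ℝ, ∀ p ∈ domain d T, |g p| ≤ M) :
    Tendsto (fun n => discreteLoss T g n θ β C) atTop (𝓝 (loss T g θ β C)) := by
  have hD := isOpen_domain d T
  obtain ⟨B, hB0, hB⟩ := exists_sq_sub_le T θ β C hgb
  have hloss : loss T g θ β C =
      ∫ p in domain d T, (hybridSurrogate T θ β C p - g p) ^ 2 :=
    (setIntegral_prod (μ := volume) (ν := volume) _
      (integrableOn_sq_sub T θ β C hg hgb)).symm
  -- `g` is controlled only on the domain, so the integrand is extended by zero. The exterior, null
  -- for the restricted measure, joins the exceptional closed set and absorbs any jump at the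
  -- boundary; no grid point lies there.
  let h : SpaceTime d → ℝ :=
    (domain d T).indicator fun p => (hybridSurrogate T θ β C p - g p) ^ 2
  have key := tendsto_quadrature_of_continuousOn_compl
    (μ := volume.restrict (domain d T)) (w := fun n => legendreWeight (d := d) T n)
    (x := fun n => gridPoint T n) (K := (domain d T)ᶜ ∪ shockGraph C) (h := h) (M := B)
    (legendreWeight_nonneg T) (fun f hf _ => tendsto_sum_legendreWeight_mul hT hf)
    (hD.isClosed_compl.union (isClosed_shockGraph C))
    ⟨(0, 0), Or.inl fun hmem => lt_irrefl _ hmem.2.1⟩ ?_ ?_ ?_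
  · rw [hloss, ← setIntegral_congr_fun hD.measurableSet
      fun p hp => Set.indicator_of_mem hp fun p => (hybridSurrogate T θ β C p - g p) ^ 2]
    refine key.congr fun n => ?_
    rw [discreteLoss_eq_sum]
    refine Finset.sum_congr rfl fun α _ => ?_
    simp only [h, Set.indicator_of_mem (gridPoint_mem_domain hT n α)]
  · refine measure_union_null ?_ ?_
    · rw [Measure.restrict_apply hD.measurableSet.compl, Set.compl_inter_self, measure_empty]
    · exact Measure.absolutelyContinuous_of_le Measure.restrict_le_self (volume_shockGraph C)
  · intro p
    by_cases hp : p ∈ domain d T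
    · simpa only [h, Set.indicator_of_mem hp] using hB p hp
    · simpa only [h, Set.indicator_of_notMem hp, abs_zero] using hB0
  · rw [Set.compl_union, compl_compl]
    refine ContinuousOn.congr (f := fun p => (hybridSurrogate T θ β C p - g p) ^ 2) ?_
      fun p hp => Set.indicator_of_mem hp.1 _
    exact (((continuousOn_hybridSurrogate T θ β C).mono Set.inter_subset_right).sub
      (hg.mono Set.inter_subset_left)).pow 2

end HybridSurrogate

end

theorem mainTheorem3 (d k m : ℕ) (T : ℝ) (hT : 0 < T)
    (θ : HybridSurrogate.MultiIndex k (d + 1) → ℝ) (β : ℝ)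
    (C : HybridSurrogate.MultiIndex m d → ℝ)
    (g : HybridSurrogate.SpaceTime d → ℝ)
    (hg : ContinuousOn g (HybridSurrogate.domain d T))
    (hgb : ∃ M : ℝ, ∀ p ∈ HybridSurrogate.domain d T, |g p| ≤ M) :
    MeasureTheory.IntegrableOn
      (fun p => (HybridSurrogate.hybridSurrogate T θ β C p - g p) ^ 2)
      (HybridSurrogate.domain d T) ∧
    Filter.Tendsto (fun n : ℕ => HybridSurrogate.discreteLoss T g n θ β C)
      Filter.atTop (nhds (HybridSurrogate.loss T g θ β C)) := by
  exact ⟨HybridSurrogate.integrableOn_sq_sub T θ β C hg hgb,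
    HybridSurrogate.tendsto_discreteLoss hT θ β C hg hgb⟩
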